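/- Let $n\ge 0$ and let $\Lambda_1,\Lambda_2\subset\mathbb R^n$ be lattices (discrete subgroups spanning $\mathbb R^n$), with associated flat tori $T_i=\mathbb R^n/\Lambda_i$. For $x\in\mathbb R$ let $N_{T_i}(x)$ be the dimension of the span of all eigenspaces, for eigenvalues $\lambda\le x$, of the nonnegative Laplace operator $-\sum_j\partial_j^2$ acting on smooth complex-valued functions on $T_i$; that is, the number of eigenvalues not exceeding $x$, counted with multiplicity. Say that $T_2$ is subspectral to $T_1$ if $N_{T_2}(x)\ge N_{T_1}(x)$ for all $x\in\mathbb R$. Let $\operatorname{sys}(T_i)$ be the length of a shortest nonconstant closed geodesic of $T_i$ (for $n=0$ there is none, and we put $\operatorname{sys}(T_i)=0$). If $T_1$ and $T_2$ have equal volume and $T_2$ is subspectral to $T_1$, then $$\operatorname{sys}(T_1)\le\operatorname{sys}(T_2),\qquad\text{and also}\qquad \operatorname{sys}(T_2)\le\operatorname{sys}(T_1).$$ -/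

import Mathlib

open scoped ContDiff Laplacian

noncomputable section

/-- The flat torus `ℝⁿ / Λ`. -/
abbrev FlatTorus {n : ℕ} (Λ : Submodule ℤ (EuclideanSpace ℝ (Fin n))) : Type :=
  EuclideanSpace ℝ (Fin n) ⧸ Λ

namespace FlatTorus

variable {n : ℕ} (Λ : Submodule ℤ (EuclideanSpace ℝ (Fin n)))

/-- The covering map `ℝⁿ → ℝⁿ / Λ`, which is a local isometry for the flat metric. -/
def proj (x : EuclideanSpace ℝ (Fin n)) : FlatTorus Λ := Submodule.Quotient.mk x

/-- The Riemannian volume of `ℝⁿ / Λ`: the Lebesgue measure of a fundamental domain of `Λ`. -/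
def vol : ℝ := ZLattice.covolume Λ

/-- The space `C^∞(ℝⁿ / Λ, ℂ)`. As the covering map is a local diffeomorphism, a function on the
torus is smooth iff its pullback to `ℝⁿ` is. -/
def smoothFunctions : Submodule ℂ (FlatTorus Λ → ℂ) where
  carrier := {f | ContDiff ℝ ∞ (f ∘ proj Λ)}
  add_mem' {f g} hf hg := by
    rw [Set.mem_ofPred_eq] at *
    exact hf.add hg
  zero_mem' := by
    rw [Set.mem_ofPred_eq]
    exact contDiff_const
  smul_mem' c f hf := by
    rw [Set.mem_ofPred_eq] at *
    exact hf.const_smul c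

variable {Λ}

theorem proj_add_of_mem {v : EuclideanSpace ℝ (Fin n)} (hv : v ∈ Λ)
    (x : EuclideanSpace ℝ (Fin n)) : proj Λ (x + v) = proj Λ x := by
  refine (Submodule.Quotient.eq Λ).2 ?_
  simpa using hv

/-- The Laplacian of a `Λ`-periodic function is `Λ`-periodic. -/
theorem laplacian_comp_proj_congr (f : FlatTorus Λ → ℂ) {x y : EuclideanSpace ℝ (Fin n)}
    (h : proj Λ x = proj Λ y) : (Δ (f ∘ proj Λ)) x = (Δ (f ∘ proj Λ)) y := by
  have hv : x - y ∈ Λ := (Submodule.Quotient.eq Λ).1 h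
  have hper : (fun z => (f ∘ proj Λ) (z + (x - y))) = f ∘ proj Λ := by
    funext z
    simp [proj_add_of_mem hv]
  have key : iteratedFDeriv ℝ 2 (f ∘ proj Λ) x = iteratedFDeriv ℝ 2 (f ∘ proj Λ) y := by
    have h2 := iteratedFDeriv_comp_add_right (𝕜 := ℝ) (f := f ∘ proj Λ) 2 (x - y) y
    rw [hper] at h2
    rw [h2]
    congr 1
    abel
  simp only [InnerProductSpace.laplacian_eq_iteratedFDeriv_stdOrthonormalBasis, key]

/-- The function on the torus whose pullback to `ℝⁿ` is `- ∑ i, ∂ᵢ² (f ∘ proj Λ)`. -/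
def negLaplacianFun (f : FlatTorus Λ → ℂ) : FlatTorus Λ → ℂ := fun q =>
  Quotient.liftOn' q (fun x => - (Δ (f ∘ proj Λ)) x) fun _ _ hxy =>
    congrArg Neg.neg (laplacian_comp_proj_congr f (Quotient.sound' hxy))

theorem negLaplacianFun_proj (f : FlatTorus Λ → ℂ) (x : EuclideanSpace ℝ (Fin n)) :
    negLaplacianFun f (proj Λ x) = - (Δ (f ∘ proj Λ)) x := rfl

theorem contDiff_laplacian {f : EuclideanSpace ℝ (Fin n) → ℂ} (hf : ContDiff ℝ ∞ f) :
    ContDiff ℝ ∞ (Δ f) := by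
  rw [InnerProductSpace.laplacian_eq_iteratedFDeriv_stdOrthonormalBasis]
  refine ContDiff.sum fun i _ => ?_
  have h2 : ContDiff ℝ ∞ (iteratedFDeriv ℝ 2 f) :=
    hf.iteratedFDeriv_right (m := ∞) (i := 2) (by norm_cast)
  exact (ContinuousMultilinearMap.apply ℝ
    (fun _ : Fin 2 => EuclideanSpace ℝ (Fin n)) ℂ _).contDiff.comp h2

variable (Λ)

/-- The nonnegative Laplace operator `f ↦ - ∑ i, ∂ᵢ² f` on `C^∞(ℝⁿ / Λ, ℂ)`. -/
def laplace : Module.End ℂ (smoothFunctions Λ) where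
  toFun f := ⟨negLaplacianFun (f : FlatTorus Λ → ℂ), by
    have h : negLaplacianFun (f : FlatTorus Λ → ℂ) ∘ proj Λ
        = - Δ ((f : FlatTorus Λ → ℂ) ∘ proj Λ) := rfl
    change ContDiff ℝ ∞ _
    rw [h]
    exact (contDiff_laplacian f.2).neg⟩
  map_add' f g := by
    ext q
    induction q using Submodule.Quotient.induction_on with
    | _ x =>
      have hf : ContDiff ℝ ∞ ((f : FlatTorus Λ → ℂ) ∘ proj Λ) := f.2
      have hg : ContDiff ℝ ∞ ((g : FlatTorus Λ → ℂ) ∘ proj Λ) := g.2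
      have h := (hf.contDiffAt.of_le (by norm_cast)).laplacian_add
        (x := x) (hg.contDiffAt.of_le (by norm_cast))
      change - (Δ (((f : FlatTorus Λ → ℂ) ∘ proj Λ) + ((g : FlatTorus Λ → ℂ) ∘ proj Λ))) x
        = - (Δ ((f : FlatTorus Λ → ℂ) ∘ proj Λ)) x + - (Δ ((g : FlatTorus Λ → ℂ) ∘ proj Λ)) x
      rw [h, neg_add]
  map_smul' c f := by
    ext q
    induction q using Submodule.Quotient.induction_on with
    | _ x =>
      have hf : ContDiff ℝ ∞ ((f : FlatTorus Λ → ℂ) ∘ proj Λ) := f.2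
      have h := InnerProductSpace.laplacian_smul c
        (hf.contDiffAt.of_le (by norm_cast) : ContDiffAt ℝ 2 _ x)
      change - (Δ (c • ((f : FlatTorus Λ → ℂ) ∘ proj Λ))) x
        = c • - (Δ ((f : FlatTorus Λ → ℂ) ∘ proj Λ)) x
      rw [h, smul_neg]

/-- The span of the eigenspaces of the Laplace operator for the eigenvalues `≤ x`. -/
def spectralSubspace (x : ℝ) : Submodule ℂ (smoothFunctions Λ) :=
  ⨆ (μ : ℝ) (_ : μ ≤ x), (laplace Λ).eigenspace (μ : ℂ)

/-- The spectral counting function: the number of eigenvalues `≤ x`, with multiplicity. -/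
def counting (x : ℝ) : Cardinal.{0} := Module.rank ℂ (spectralSubspace Λ x)

/-- `ℝⁿ / Λ` is (Laplace) subspectral to `ℝᵐ / Λ'`: its counting function is everywhere at least
that of `ℝᵐ / Λ'`. -/
def Subspectral {m : ℕ} (Λ' : Submodule ℤ (EuclideanSpace ℝ (Fin m))) : Prop :=
  ∀ x : ℝ, counting Λ' x ≤ counting Λ x

/-- `γ`, of period `1`, is a (nonconstant) closed geodesic of `ℝⁿ / Λ` of length `L`. Geodesics of
the flat torus are the curves whose lifts `c` to `ℝⁿ` solve the geodesic equation `c'' = 0`. -/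
def IsClosedGeodesic (γ : ℝ → FlatTorus Λ) (L : ℝ) : Prop :=
  (∀ t, γ (t + 1) = γ t) ∧
    ∃ c : ℝ → EuclideanSpace ℝ (Fin n), ContDiff ℝ ∞ c ∧ (∀ t, γ t = proj Λ (c t)) ∧
      (∀ t, deriv (deriv c) t = 0) ∧ (∃ t, deriv c t ≠ 0) ∧ L = ∫ t in (0 : ℝ)..1, ‖deriv c t‖

/-- The systole of `ℝⁿ / Λ`: the length of a shortest closed geodesic. -/
def systole : ℝ := sInf {L : ℝ | ∃ γ : ℝ → FlatTorus Λ, IsClosedGeodesic Λ γ L}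

end FlatTorus

end

/-! Let `Z_i(t)` be the heat trace of `T_i`. Since `e^{-tμ}/t` is the integral of `e^{-tx}` over `x
≥ μ`, the quotient `Z_i(t)/t` is the Laplace transform of the counting function `N_i`. Hence `(Z₂ -
Z₁)/t`, the transform of `N₂ - N₁ ≥ 0` (supported on `x ≥ 0`), is nonnegative and nonincreasing in
`t` (`heatTrace_le_heatTrace`, `heatTrace_sub_div_antitone`).

Poisson summation (`tsum_exp_dualVec_eq`) writes `Z_i(t)` as `V (4πt)^{-n/2}` times the Gaussian sum
of `exp(-‖v‖²/4t)` over `Λ_i`. Because the volumes agree, the contributions of `v = 0` cancel, and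
as `t → 0` the difference, even divided by `t`, is at most a power of `t` times `e^{-c/t}`. A
nonnegative nonincreasing function with limit `0` at `0` vanishes. So the Gaussian sums of the two
lattices coincide for every parameter (`tsum_exp_eq_of_subspectral`).

Letting the parameter tend to infinity, the Gaussian sum detects the shortest nonzero length
(`ZLattice.exists_norm_le_of_tsum_exp_eq`), and this length is the systole. The equality is
symmetric in the two tori, whence both inequalities.

The spectrum itself is computed by Fourier series: the characters of the dual lattice are
independent eigenfunctions, and every eigenfunction is a finite combination of them
(`counting_eq_ncard`). -/

noncomputable section

open scoped Pointwise
open MeasureTheory Filter Topology Submodule Module Set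

/-! ### Heat traces as Laplace transforms of counting functions. -/

section HeatTrace

/-- The Laplace transform of the indicator function of a half-line. -/
theorem lintegral_indicator_Ici_exp_neg_mul {t : ℝ} (ht : 0 < t) (m : ℝ) :
    ∫⁻ x, (Ici m).indicator (fun x => ENNReal.ofReal (Real.exp (-t * x))) x =
      ENNReal.ofReal (Real.exp (-t * m) / t) := by
  rw [lintegral_indicator measurableSet_Ici, setLIntegral_congr Ioi_ae_eq_Ici.symm,
    ← ofReal_integral_eq_lintegral_ofReal (integrableOn_exp_mul_Ioi (neg_lt_zero.2 ht) m)
      (Eventually.of_forall fun x => (Real.exp_pos _).le),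
    integral_exp_mul_Ioi (neg_lt_zero.2 ht)]
  congr 1
  rw [neg_div, div_neg, neg_neg]

/-- The heat trace is the Laplace transform of the counting function, up to the factor `t`. -/
theorem tsum_ofReal_exp_div_eq_lintegral {κ : Type*} [Countable κ] {μ : κ → ℝ}
    (hfin : ∀ x, {k | μ k ≤ x}.Finite) {t : ℝ} (ht : 0 < t) :
    ∑' k, ENNReal.ofReal (Real.exp (-t * μ k) / t) =
      ∫⁻ x, ENNReal.ofReal ({k | μ k ≤ x}.ncard * Real.exp (-t * x)) := by
  simp_rw [← lintegral_indicator_Ici_exp_neg_mul ht]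
  rw [← lintegral_tsum fun k =>
    (Measurable.indicator (by fun_prop) measurableSet_Ici).aemeasurable]
  refine lintegral_congr fun x => ?_
  -- For fixed `x`, the indicators that contribute are those of the `k` with `μ k ≤ x`, so the sum
  -- counts them.
  have h : ∀ k, (Ici (μ k)).indicator (fun x => ENNReal.ofReal (Real.exp (-t * x))) x =
      {k | μ k ≤ x}.indicator (fun _ => ENNReal.ofReal (Real.exp (-t * x))) k := fun k => rfl
  simp_rw [h]
  rw [← tsum_subtype, ENNReal.tsum_const, ENNReal.ofReal_mul (by positivity),
    ENNReal.ofReal_natCast]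
  congr 1
  rw [ENat.card_coe_set_eq, ← (hfin x).cast_ncard_eq]
  simp

theorem ofReal_heatTrace_div_eq_lintegral {κ : Type*} [Countable κ] {μ : κ → ℝ}
    (hfin : ∀ x, {k | μ k ≤ x}.Finite) {t : ℝ} (ht : 0 < t)
    (hsum : Summable fun k => Real.exp (-t * μ k)) :
    ENNReal.ofReal ((∑' k, Real.exp (-t * μ k)) / t) =
      ∫⁻ x, ENNReal.ofReal ({k | μ k ≤ x}.ncard * Real.exp (-t * x)) := by
  rw [← tsum_ofReal_exp_div_eq_lintegral hfin ht, ← tsum_div_const,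
    ENNReal.ofReal_tsum_of_nonneg (fun k => by positivity) (hsum.div_const t)]

theorem heatTrace_div_nonneg {κ : Type*} (μ : κ → ℝ) {t : ℝ} (ht : 0 < t) :
    0 ≤ (∑' k, Real.exp (-t * μ k)) / t :=
  div_nonneg (tsum_nonneg fun _ => (Real.exp_pos _).le) ht.le

/-- This is `(N₂ - N₁)(e^{-sx} - e^{-tx}) ≥ 0`, rearranged without subtraction so that it can be
integrated in `ENNReal`. -/
theorem exp_mul_add_exp_mul_le {N₁ N₂ s t x : ℝ} (hN : N₁ ≤ N₂) (hst : s ≤ t)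
    (h0 : 0 ≤ x) :
    N₂ * Real.exp (-t * x) + N₁ * Real.exp (-s * x) ≤
      N₂ * Real.exp (-s * x) + N₁ * Real.exp (-t * x) := by
  have : Real.exp (-t * x) ≤ Real.exp (-s * x) := by
    apply Real.exp_le_exp.2
    nlinarith
  nlinarith

/-- If a nonnegative family has everywhere larger counting function than another one, then the
difference of the heat traces, divided by `t`, is nonincreasing. -/
theorem heatTrace_sub_div_antitone {κ₁ κ₂ : Type*} [Countable κ₁] [Countable κ₂] {μ₁ : κ₁ → ℝ}
    {μ₂ : κ₂ → ℝ} (hfin₁ : ∀ x, {k | μ₁ k ≤ x}.Finite) (hfin₂ : ∀ x, {k | μ₂ k ≤ x}.Finite)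
    (h0₁ : ∀ k, 0 ≤ μ₁ k) (h0₂ : ∀ k, 0 ≤ μ₂ k)
    (hs₁ : ∀ t, 0 < t → Summable fun k => Real.exp (-t * μ₁ k))
    (hs₂ : ∀ t, 0 < t → Summable fun k => Real.exp (-t * μ₂ k))
    (hle : ∀ x, {k | μ₁ k ≤ x}.ncard ≤ {k | μ₂ k ≤ x}.ncard) {s t : ℝ} (hs : 0 < s)
    (hst : s ≤ t) :
    (∑' k, Real.exp (-t * μ₂ k) - ∑' k, Real.exp (-t * μ₁ k)) / t ≤
      (∑' k, Real.exp (-s * μ₂ k) - ∑' k, Real.exp (-s * μ₁ k)) / s := by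
  have ht : 0 < t := hs.trans_le hst
  have hmeas : ∀ {κ : Type _} {μ : κ → ℝ}, (∀ x, {k | μ k ≤ x}.Finite) → ∀ t : ℝ,
      Measurable fun x => ENNReal.ofReal ({k | μ k ≤ x}.ncard * Real.exp (-t * x)) := by
    intro κ μ hfin t
    have hmono : Monotone fun x => ({k | μ k ≤ x}.ncard : ℝ) := fun x y hxy =>
      Nat.cast_le.2 (ncard_le_ncard (fun k hk => le_trans hk hxy) (hfin y))
    exact (hmono.measurable.mul (by fun_prop)).ennreal_ofReal
  have main : ENNReal.ofReal ((∑' k, Real.exp (-t * μ₂ k)) / t) +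
      ENNReal.ofReal ((∑' k, Real.exp (-s * μ₁ k)) / s) ≤
      ENNReal.ofReal ((∑' k, Real.exp (-s * μ₂ k)) / s) +
      ENNReal.ofReal ((∑' k, Real.exp (-t * μ₁ k)) / t) := by
    rw [ofReal_heatTrace_div_eq_lintegral hfin₁ hs (hs₁ s hs),
      ofReal_heatTrace_div_eq_lintegral hfin₁ ht (hs₁ t ht),
      ofReal_heatTrace_div_eq_lintegral hfin₂ hs (hs₂ s hs),
      ofReal_heatTrace_div_eq_lintegral hfin₂ ht (hs₂ t ht),
      ← lintegral_add_left (hmeas hfin₂ t), ← lintegral_add_left (hmeas hfin₂ s)]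
    refine lintegral_mono fun x => ?_
    simp only
    rw [← ENNReal.ofReal_add (by positivity) (by positivity),
      ← ENNReal.ofReal_add (by positivity) (by positivity)]
    apply ENNReal.ofReal_le_ofReal
    rcases le_or_gt 0 x with hx | hx
    · exact exp_mul_add_exp_mul_le (Nat.cast_le.2 (hle x)) hst hx
    -- For `x < 0` the exponentials compare the other way, but both counting functions vanish.
    · have e₁ : {k | μ₁ k ≤ x} = ∅ :=
        eq_empty_of_forall_notMem fun k hk => absurd (h0₁ k) (not_le.2 (lt_of_le_of_lt hk hx))
      have e₂ : {k | μ₂ k ≤ x} = ∅ :=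
        eq_empty_of_forall_notMem fun k hk => absurd (h0₂ k) (not_le.2 (lt_of_le_of_lt hk hx))
      simp [e₁, e₂]
  rw [← ENNReal.ofReal_add (heatTrace_div_nonneg μ₂ ht) (heatTrace_div_nonneg μ₁ hs), ← ENNReal.ofReal_add (heatTrace_div_nonneg μ₂ hs) (heatTrace_div_nonneg μ₁ ht),
    ENNReal.ofReal_le_ofReal_iff (add_nonneg (heatTrace_div_nonneg μ₂ hs) (heatTrace_div_nonneg μ₁ ht))] at main
  rw [sub_div, sub_div]
  linarith

/-- A family with everywhere larger counting function has the larger heat trace. -/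
theorem heatTrace_le_heatTrace {κ₁ κ₂ : Type*} [Countable κ₁] [Countable κ₂] {μ₁ : κ₁ → ℝ}
    {μ₂ : κ₂ → ℝ} (hfin₁ : ∀ x, {k | μ₁ k ≤ x}.Finite) (hfin₂ : ∀ x, {k | μ₂ k ≤ x}.Finite)
    (hs₁ : ∀ t, 0 < t → Summable fun k => Real.exp (-t * μ₁ k))
    (hs₂ : ∀ t, 0 < t → Summable fun k => Real.exp (-t * μ₂ k))
    (hle : ∀ x, {k | μ₁ k ≤ x}.ncard ≤ {k | μ₂ k ≤ x}.ncard) {t : ℝ} (ht : 0 < t) :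
    ∑' k, Real.exp (-t * μ₁ k) ≤ ∑' k, Real.exp (-t * μ₂ k) := by
  have main : ENNReal.ofReal ((∑' k, Real.exp (-t * μ₁ k)) / t) ≤
      ENNReal.ofReal ((∑' k, Real.exp (-t * μ₂ k)) / t) := by
    rw [ofReal_heatTrace_div_eq_lintegral hfin₁ ht (hs₁ t ht),
      ofReal_heatTrace_div_eq_lintegral hfin₂ ht (hs₂ t ht)]
    refine lintegral_mono fun x => ENNReal.ofReal_le_ofReal ?_
    have := hle x
    gcongr
  rw [ENNReal.ofReal_le_ofReal_iff (heatTrace_div_nonneg μ₂ ht)] at main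
  exact (div_le_div_iff_of_pos_right ht).1 main

end HeatTrace

/-! ### Gaussian sums over discrete subgroups. -/

section GaussianSum

theorem Submodule.exists_pos_le_norm_of_discrete {E : Type*} [NormedAddCommGroup E]
    (L : Submodule ℤ E) [DiscreteTopology L] :
    ∃ δ > 0, ∀ v : L, v ≠ 0 → δ ≤ ‖v‖ := by
  obtain ⟨δ, hδ, h⟩ := Metric.isOpen_singleton_iff.1 (isOpen_discrete ({0} : Set L) )
  refine ⟨δ, hδ, fun v hv => ?_⟩
  by_contra! hlt
  exact hv (h v (by simpa using hlt))

variable {E : Type*} [NormedAddCommGroup E] [NormedSpace ℝ E] [FiniteDimensional ℝ E]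

/-- From `e^y ≥ y^m/m!`, the terms are dominated by a multiple of `‖v‖^{-2m}`, summable once `2m`
exceeds the rank. -/
theorem ZLattice.summable_exp_neg_mul_sq_norm (L : Submodule ℤ E) [DiscreteTopology L] {a : ℝ}
    (ha : 0 < a) : Summable fun v : L => Real.exp (-a * ‖v‖ ^ 2) := by
  set m := finrank ℤ L + 1 with hm
  have hsum := (ZLattice.summable_norm_pow_inv L (2 * m) (by omega)).mul_left
    ((m.factorial : ℝ) / a ^ m)
  refine Summable.of_norm_bounded_eventually hsum ?_
  -- The bound may fail only at `v = 0`, where `‖0‖⁻¹ = 0` makes its right side zero.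
  refine (finite_singleton (0 : L)).subset fun v hv => ?_
  by_contra h0
  apply hv
  have hv0 : 0 < ‖v‖ := norm_pos_iff.2 h0
  change ‖Real.exp (-a * ‖v‖ ^ 2)‖ ≤ m.factorial / a ^ m * ‖v‖⁻¹ ^ (2 * m)
  rw [Real.norm_of_nonneg (Real.exp_pos _).le]
  have h := Real.pow_div_factorial_le_exp (a * ‖v‖ ^ 2) (by positivity) m
  rw [neg_mul, Real.exp_neg]
  calc (Real.exp (a * ‖v‖ ^ 2))⁻¹ ≤ ((a * ‖v‖ ^ 2) ^ m / m.factorial)⁻¹ := by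
        apply inv_anti₀ (by positivity) h
    _ = _ := by
        rw [inv_div, mul_pow, ← pow_mul, inv_pow]
        field_simp

/-- The nonzero lattice vectors contribute little to a Gaussian sum with a large parameter. -/
theorem ZLattice.exists_tsum_exp_sub_one_le (L : Submodule ℤ E) [DiscreteTopology L] :
    ∃ c > 0, ∃ C, ∀ a ≥ 1, 0 ≤ ∑' v : L, Real.exp (-a * ‖v‖ ^ 2) - 1 ∧
      ∑' v : L, Real.exp (-a * ‖v‖ ^ 2) - 1 ≤ C * Real.exp (-c * a) := by
  classical
  obtain ⟨δ, hδ, h⟩ := L.exists_pos_le_norm_of_discrete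
  -- Half of `a‖v‖²` is at least `aδ²/2`, giving the decay; the other half is at least `‖v‖²/2` as
  -- `a ≥ 1`, giving the convergent sum `C`.
  refine ⟨δ ^ 2 / 2, by positivity, ∑' v : L, Real.exp (-(1 / 2) * ‖v‖ ^ 2), fun a ha => ?_⟩
  have ha0 : 0 < a := by linarith
  have hsum := ZLattice.summable_exp_neg_mul_sq_norm L ha0
  rw [hsum.tsum_eq_add_tsum_ite 0]
  simp only [norm_zero, ne_eq, OfNat.ofNat_ne_zero, not_false_eq_true, zero_pow, mul_zero,
    Real.exp_zero, add_sub_cancel_left]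
  refine ⟨tsum_nonneg fun v => by split_ifs <;> positivity, ?_⟩
  rw [← tsum_mul_right]
  refine Summable.tsum_le_tsum_of_inj id Function.injective_id (fun v hv => by positivity)
    (fun v => ?_) ?_ ?_
  · split_ifs with hv
    · positivity
    · rw [← Real.exp_add]
      apply Real.exp_le_exp.2
      have h1 : δ ^ 2 ≤ ‖v‖ ^ 2 := pow_le_pow_left₀ hδ.le (h v hv) 2
      have h2 : 0 ≤ (a - 1) * ‖v‖ ^ 2 := mul_nonneg (by linarith) (by positivity)
      have h3 : 0 ≤ a * (‖v‖ ^ 2 - δ ^ 2) := mul_nonneg ha0.le (by linarith)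
      simp only [id]
      linarith
  · refine Summable.of_nonneg_of_le (fun v => ?_) (fun v => ?_) hsum
    · split_ifs <;> positivity
    · split_ifs <;> [positivity; rfl]
  · exact (ZLattice.summable_exp_neg_mul_sq_norm L (by norm_num)).mul_right _

/-- Discrete subgroups with the same Gaussian sums: the first one has a nonzero vector at least as
short as any given nonzero vector of the second one. -/
theorem ZLattice.exists_norm_le_of_tsum_exp_eq (L₁ L₂ : Submodule ℤ E) [DiscreteTopology L₁]
    [DiscreteTopology L₂]
    (h : ∀ a : ℝ, 0 < a → ∑' v : L₁, Real.exp (-a * ‖v‖ ^ 2) = ∑' v : L₂, Real.exp (-a * ‖v‖ ^ 2))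
    (v : L₂) (hv : v ≠ 0) : ∃ w : L₁, w ≠ 0 ∧ ‖w‖ ≤ ‖v‖ := by
  classical
  by_contra! hw
  have hsum (a : ℝ) (ha : 0 < a) := ZLattice.summable_exp_neg_mul_sq_norm L₁ ha
  -- Keep only `0` and `v` in the sum over `L₂`, cancel the terms at `0`, and multiply by
  -- `exp(a‖v‖²)`. If all nonzero `w` were longer than `v`, the resulting sum would tend to `0` as
  -- `a → ∞`.
  have hlow : ∀ a : ℝ, 0 < a → 1 ≤ ∑' w : L₁,
      if w = 0 then 0 else Real.exp (-a * (‖w‖ ^ 2 - ‖v‖ ^ 2)) := by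
    intro a ha
    have h2 := (ZLattice.summable_exp_neg_mul_sq_norm L₂ ha).sum_le_tsum {0, v}
      (fun _ _ => (Real.exp_pos _).le)
    rw [← h a ha, (hsum a ha).tsum_eq_add_tsum_ite 0, Finset.sum_pair hv.symm] at h2
    simp only [norm_zero] at h2
    have h3 : Real.exp (-a * ‖v‖ ^ 2) ≤ ∑' w : L₁,
      if w = 0 then 0 else Real.exp (-a * ‖w‖ ^ 2) := le_of_add_le_add_left h2
    have h4 := mul_le_mul_of_nonneg_left h3 (Real.exp_pos (a * ‖v‖ ^ 2)).le
    rw [← Real.exp_add, ← tsum_mul_left] at h4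
    refine (le_of_eq ?_).trans (h4.trans (le_of_eq (tsum_congr fun w => ?_)))
    · rw [neg_mul, add_neg_cancel, Real.exp_zero]
    · split_ifs
      · simp
      · rw [← Real.exp_add]
        congr 1
        ring
  have hlim : Tendsto (fun a : ℝ => ∑' w : L₁,
      if w = 0 then 0 else Real.exp (-a * (‖w‖ ^ 2 - ‖v‖ ^ 2))) atTop (𝓝 (∑' w : L₁, 0)) := by
    refine tendsto_tsum_of_dominated_convergence
      (bound := fun w => Real.exp (‖v‖ ^ 2) * Real.exp (-1 * ‖w‖ ^ 2))
      ((hsum 1 one_pos).mul_left _) (fun w => ?_) ?_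
    · split_ifs with h0
      · exact tendsto_const_nhds
      · have hpos : 0 < ‖w‖ ^ 2 - ‖v‖ ^ 2 := sub_pos.2
          (pow_lt_pow_left₀ (hw w h0) (norm_nonneg _) two_ne_zero)
        refine Real.tendsto_exp_atBot.comp ?_
        exact (tendsto_neg_atTop_atBot).atBot_mul_const hpos
    · filter_upwards [eventually_ge_atTop 1] with a ha w
      split_ifs with h0
      · simp only [norm_zero]
        positivity
      · rw [Real.norm_of_nonneg (Real.exp_pos _).le, ← Real.exp_add]
        apply Real.exp_le_exp.2
        have hpos : 0 < ‖w‖ ^ 2 - ‖v‖ ^ 2 := sub_pos.2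
          (pow_lt_pow_left₀ (hw w h0) (norm_nonneg _) two_ne_zero)
        nlinarith
  rw [tsum_zero] at hlim
  have := ge_of_tendsto hlim ((eventually_gt_atTop 0).mono hlow)
  norm_num at this

end GaussianSum

/-! ### Dual lattice, characters and Fourier series of periodic functions. -/

namespace LatticeFourier

variable {E : Type*} [NormedAddCommGroup E] [InnerProductSpace ℝ E] {ι : Type*}

/-- The projection of `E` to the standard torus given by the coordinates with respect to `b`. -/
def torusMap (b : Basis ι ℝ E) (x : E) : UnitAddTorus ι := fun i => (b.repr x i : UnitAddCircle)

theorem torusMap_eq_iff (b : Basis ι ℝ E) {x y : E} :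
    torusMap b x = torusMap b y ↔ x - y ∈ span ℤ (range b) := by
  rw [b.mem_span_iff_repr_mem ℤ, funext_iff]
  refine forall_congr' fun i => ?_
  simp only [torusMap]
  rw [← sub_eq_zero, ← AddCircle.coe_sub, AddCircle.coe_eq_zero_iff]
  simp

variable [Fintype ι]

theorem isOpenQuotientMap_torusMap (b : Basis ι ℝ E) : IsOpenQuotientMap (torusMap b) := by
  have h : IsOpenQuotientMap
      (Pi.map fun (_ : ι) => (QuotientAddGroup.mk : ℝ → UnitAddCircle)) :=
    IsOpenQuotientMap.piMap fun i => QuotientAddGroup.isOpenQuotientMap_mk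
  exact h.comp b.equivFunL.toHomeomorph.isOpenQuotientMap

theorem repr_equivFunL_symm (b : Basis ι ℝ E) (y : ι → ℝ) (i : ι) :
    b.repr (b.equivFunL.symm y) i = y i :=
  congrFun (b.equivFun.apply_symm_apply y) i

theorem preimage_fundamentalDomain (b : Basis ι ℝ E) :
    b.equivFunL.symm ⁻¹' (ZSpan.fundamentalDomain b) =
      Set.univ.pi fun _ : ι => Ico (0 : ℝ) 1 := by
  ext y
  simp [ZSpan.mem_fundamentalDomain, Set.mem_pi, repr_equivFunL_symm]

variable [FiniteDimensional ℝ E]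

/-- The vector `w` of the dual lattice with `⟪w, b i⟫ = k i` for all `i`. -/
def dualVec (b : Basis ι ℝ E) (k : ι → ℤ) : E :=
  (InnerProductSpace.toDual ℝ E).symm
    (LinearMap.toContinuousLinearMap (∑ i, (k i : ℝ) • b.coord i))

theorem inner_dualVec (b : Basis ι ℝ E) (k : ι → ℤ) (x : E) :
    inner ℝ (dualVec b k) x = ∑ i, (k i : ℝ) * b.repr x i := by
  rw [dualVec, InnerProductSpace.toDual_symm_apply]
  simp

/-- Cauchy–Schwarz for `k i = ⟪w, b i⟫`. It bounds the integer coordinates by the norm, which yields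
finiteness and summability over the dual lattice. -/
theorem abs_le_norm_dualVec (b : Basis ι ℝ E) (k : ι → ℤ) (i : ι) :
    |(k i : ℝ)| ≤ ‖dualVec b k‖ * ‖b i‖ := by
  have h : inner ℝ (dualVec b k) (b i) = (k i : ℝ) := by
    classical
    simp [inner_dualVec, Finsupp.single_apply]
  rw [← h]
  exact abs_real_inner_le_norm _ _

theorem finite_norm_dualVec_le (b : Basis ι ℝ E) (R : ℝ) : {k | ‖dualVec b k‖ ≤ R}.Finite := by
  have hfin : (Set.univ.pi fun i => Icc (-⌈R * ‖b i‖⌉) ⌈R * ‖b i‖⌉).Finite :=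
    Set.Finite.pi fun i => finite_Icc _ _
  refine hfin.subset fun k hk i _ => ?_
  have hk : ‖dualVec b k‖ ≤ R := hk
  have h : |(k i : ℝ)| ≤ ⌈R * ‖b i‖⌉ := (abs_le_norm_dualVec b k i).trans
    ((mul_le_mul_of_nonneg_right hk (norm_nonneg _)).trans (Int.le_ceil _))
  have h' : |k i| ≤ ⌈R * ‖b i‖⌉ := by exact_mod_cast h
  exact abs_le.1 h'

theorem finite_eigenvalue_le (b : Basis ι ℝ E) (x : ℝ) :
    {k | 4 * Real.pi ^ 2 * ‖dualVec b k‖ ^ 2 ≤ x}.Finite := by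
  refine (finite_norm_dualVec_le b (1 + x)).subset fun k hk => ?_
  have hk : 4 * Real.pi ^ 2 * ‖dualVec b k‖ ^ 2 ≤ x := hk
  change ‖dualVec b k‖ ≤ 1 + x
  have hpi : 1 ≤ Real.pi ^ 2 := by nlinarith [Real.pi_gt_three]
  nlinarith [sq_nonneg (‖dualVec b k‖ - 1), sq_nonneg ‖dualVec b k‖, norm_nonneg (dualVec b k)]

theorem summable_exp_neg_mul_sq_norm_dualVec (b : Basis ι ℝ E) {a : ℝ} (ha : 0 < a) :
    Summable fun k => Real.exp (-a * ‖dualVec b k‖ ^ 2) := by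
  -- `M` bounds every `‖b i‖`, so the sup norm of `k` is at most `M‖dualVec b k‖` and the sum is
  -- dominated by one over the standard integer lattice.
  set M := 1 + ∑ i, ‖b i‖ with hM
  have hM0 : 0 < M := by positivity
  let φ : (ι → ℤ) → span ℤ (range (Pi.basisFun ℝ ι)) := fun k =>
    ⟨fun i => (k i : ℝ), ((Pi.basisFun ℝ ι).mem_span_iff_repr_mem ℤ _).2 fun i => ⟨k i, by simp⟩⟩
  have hφ : Function.Injective φ := fun k l h => by
    ext i
    have : (k i : ℝ) = l i := congrFun (congrArg Subtype.val h) i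
    exact_mod_cast this
  have hs := (ZLattice.summable_exp_neg_mul_sq_norm (span ℤ (range (Pi.basisFun ℝ ι)))
    (a := a / M ^ 2) (by positivity)).comp_injective hφ
  refine Summable.of_nonneg_of_le (fun k => (Real.exp_pos _).le) (fun k => ?_) hs
  apply Real.exp_le_exp.2
  have h : ‖φ k‖ ≤ ‖dualVec b k‖ * M := by
    refine (pi_norm_le_iff_of_nonneg (by positivity)).2 fun i => ?_
    refine (abs_le_norm_dualVec b k i).trans ?_
    gcongr
    have := Finset.single_le_sum (f := fun i => ‖b i‖) (fun i _ => norm_nonneg _)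
      (Finset.mem_univ i)
    linarith
  have h2 : ‖φ k‖ ^ 2 ≤ ‖dualVec b k‖ ^ 2 * M ^ 2 := by
    rw [← mul_pow]
    gcongr
  have h3 : a / M ^ 2 * ‖φ k‖ ^ 2 ≤ a * ‖dualVec b k‖ ^ 2 := by
    rw [div_mul_eq_mul_div, div_le_iff₀ (by positivity)]
    nlinarith
  linarith

/-- The character `x ↦ exp (2πi ⟪w, x⟫)` attached to the vector `w` of the dual lattice. -/
def character (b : Basis ι ℝ E) (k : ι → ℤ) (x : E) : ℂ :=
  Complex.exp (2 * Real.pi * Complex.I * (inner ℝ (dualVec b k) x : ℝ))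

theorem mFourier_torusMap (b : Basis ι ℝ E) (k : ι → ℤ) (x : E) :
    UnitAddTorus.mFourier k (torusMap b x) = character b k x := by
  simp only [UnitAddTorus.mFourier, ContinuousMap.coe_mk, torusMap, fourier_coe_apply, character,
    inner_dualVec]
  rw [← Complex.exp_sum]
  congr 1
  push_cast
  rw [Finset.mul_sum]
  refine Finset.sum_congr rfl fun i _ => ?_
  ring

theorem character_add_of_mem (b : Basis ι ℝ E) (k : ι → ℤ) (x : E) {v : E}
    (hv : v ∈ span ℤ (range b)) : character b k (x + v) = character b k x := by
  rw [← mFourier_torusMap, ← mFourier_torusMap]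
  congr 1
  rw [torusMap_eq_iff]
  simpa using hv

theorem norm_character (b : Basis ι ℝ E) (k : ι → ℤ) (x : E) : ‖character b k x‖ = 1 := by
  rw [character, show 2 * (Real.pi : ℂ) * Complex.I * (inner ℝ (dualVec b k) x : ℝ) =
    ((2 * Real.pi * inner ℝ (dualVec b k) x : ℝ) : ℂ) * Complex.I by push_cast; ring]
  exact Complex.norm_exp_ofReal_mul_I _

theorem contDiff_character (b : Basis ι ℝ E) (k : ι → ℤ) : ContDiff ℝ ∞ (character b k) := by
  unfold character
  refine Complex.contDiff_exp.comp ?_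
  refine contDiff_const.mul (Complex.ofRealCLM.contDiff.comp ?_)
  exact contDiff_const.inner ℝ contDiff_id

variable [MeasurableSpace E] [BorelSpace E]

/-- The Fourier coefficients of a function periodic under the lattice with basis `b`. -/
def fourierCoeff (b : Basis ι ℝ E) (f : E → ℂ) (k : ι → ℤ) : ℂ :=
  (volume.real (ZSpan.fundamentalDomain b))⁻¹ •
    ∫ x in ZSpan.fundamentalDomain b, character b (-k) x * f x

theorem measure_fundamentalDomain_pos (b : Basis ι ℝ E) :
    0 < volume.real (ZSpan.fundamentalDomain b) := by
  refine ENNReal.toReal_pos (ZSpan.measure_fundamentalDomain_ne_zero b) ?_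
  exact (ZSpan.fundamentalDomain_isBounded b).measure_lt_top.ne

/-- Haar measure is unique up to a factor, and the factor is read off from the unit cube, which is
carried to the fundamental domain. -/
theorem map_equivFunL_symm_volume (b : Basis ι ℝ E) :
    Measure.map b.equivFunL.symm volume =
      ENNReal.ofReal (volume.real (ZSpan.fundamentalDomain b))⁻¹ • (volume : Measure E) := by
  have : (Measure.map b.equivFunL.symm volume).IsAddHaarMeasure :=
    b.equivFunL.symm.isAddHaarMeasure_map volume
  obtain ⟨c, hc⟩ : ∃ c : NNReal, Measure.map b.equivFunL.symm volume = c • (volume : Measure E) :=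
    ⟨_, Measure.isAddLeftInvariant_eq_smul _ _⟩
  have hemb : MeasurableEmbedding b.equivFunL.symm :=
    b.equivFunL.symm.toHomeomorph.measurableEmbedding
  have hcube : Measure.map b.equivFunL.symm volume (ZSpan.fundamentalDomain b) = 1 := by
    rw [hemb.map_apply, preimage_fundamentalDomain, Real.volume_pi_Ico]
    simp
  rw [hc, Measure.smul_apply] at hcube
  have hc' : (c : ENNReal) = ENNReal.ofReal (volume.real (ZSpan.fundamentalDomain b))⁻¹ := by
    rw [ENNReal.ofReal_inv_of_pos (measure_fundamentalDomain_pos b), Measure.real,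
      ENNReal.ofReal_toReal (ZSpan.fundamentalDomain_isBounded b).measure_lt_top.ne]
    exact ENNReal.eq_inv_of_mul_eq_one_left hcube
  rw [hc, ← hc']
  rfl

theorem setIntegral_fundamentalDomain (b : Basis ι ℝ E) (f : E → ℂ) :
    ∫ y in {y : ι → ℝ | ∀ i, y i ∈ Ioc (0 : ℝ) (0 + 1)}, f (b.equivFunL.symm y) =
      (volume.real (ZSpan.fundamentalDomain b))⁻¹ • ∫ x in ZSpan.fundamentalDomain b, f x := by
  have hpos := measure_fundamentalDomain_pos b
  have hset : {y : ι → ℝ | ∀ i, y i ∈ Ioc (0 : ℝ) (0 + 1)} =ᵐ[volume]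
      b.equivFunL.symm ⁻¹' (ZSpan.fundamentalDomain b) := by
    have h1 : {y : ι → ℝ | ∀ i, y i ∈ Ioc (0 : ℝ) (0 + 1)} =
        Set.univ.pi fun _ : ι => Ioc (0 : ℝ) 1 := by
      ext y
      simp [Set.mem_pi]
    rw [h1, preimage_fundamentalDomain]
    exact Measure.univ_pi_Ioc_ae_eq_Icc.trans Measure.univ_pi_Ico_ae_eq_Icc.symm
  have hemb : MeasurableEmbedding b.equivFunL.symm :=
    b.equivFunL.symm.toHomeomorph.measurableEmbedding
  rw [setIntegral_congr_set hset, ← hemb.setIntegral_map f, map_equivFunL_symm_volume b,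
    Measure.restrict_smul, integral_smul_measure, ENNReal.toReal_ofReal (by positivity)]

/-- A continuous periodic function is the sum of its Fourier series if its Fourier coefficients
are summable. -/
theorem hasSum_fourierCoeff (b : Basis ι ℝ E) {f : E → ℂ} (hf : Continuous f)
    (hper : ∀ v ∈ span ℤ (range b), ∀ x, f (x + v) = f x) (hs : Summable (fourierCoeff b f))
    (x : E) : HasSum (fun k => fourierCoeff b f k * character b k x) (f x) := by
  have hq := (isOpenQuotientMap_torusMap b).isQuotientMap
  let q : C(E, UnitAddTorus ι) := ⟨torusMap b, hq.continuous⟩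
  have hq' : IsQuotientMap q := hq
  -- Periodicity lets `f` descend to the standard torus, where Fourier inversion is available.
  have hfac : Function.FactorsThrough (⟨f, hf⟩ : C(E, ℂ)) q := fun x y hxy => by
    have := hper _ ((torusMap_eq_iff b).1 hxy) y
    rwa [add_sub_cancel] at this
  let F : C(UnitAddTorus ι, ℂ) := hq'.lift ⟨f, hf⟩ hfac
  have hF : ∀ x, F (torusMap b x) = f x := fun x =>
    DFunLike.congr_fun (hq'.lift_comp ⟨f, hf⟩ hfac) x
  have hcoeff : UnitAddTorus.mFourierCoeff F = fourierCoeff b f := by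
    ext k
    rw [UnitAddTorus.mFourierCoeff_eq_integral _ _ 0, fourierCoeff,
      ← setIntegral_fundamentalDomain]
    refine integral_congr_ae (Eventually.of_forall fun y => ?_)
    have hy : torusMap b (b.equivFunL.symm y) = fun i => (y i : UnitAddCircle) := by
      ext i
      simp [torusMap, repr_equivFunL_symm]
    simp only [← hy, hF, mFourier_torusMap, smul_eq_mul]
  have := UnitAddTorus.hasSum_mFourier_series_apply_of_summable (f := F) (hcoeff ▸ hs)
    (torusMap b x)
  simpa only [hcoeff, hF, mFourier_torusMap, smul_eq_mul] using this

end LatticeFourier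

/-! ### Poisson summation for Gaussians. -/

namespace LatticeFourier

/-- Rests on `‖v‖² ≤ 2‖x + v‖² + 2‖x‖²`. It gives a summable majorant, uniform for bounded `x`, for
the translated Gaussians. -/
theorem exp_neg_mul_sq_norm_add_le {E : Type*} [NormedAddCommGroup E] {a R : ℝ} (ha : 0 ≤ a) {x : E} (hx : ‖x‖ ≤ R) (v : E) :
    Real.exp (-a * ‖x + v‖ ^ 2) ≤ Real.exp (a * R ^ 2) * Real.exp (-(a / 2) * ‖v‖ ^ 2) := by
  rw [← Real.exp_add]
  apply Real.exp_le_exp.2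
  have h1 : ‖v‖ ≤ ‖x + v‖ + ‖x‖ := by
    simpa using norm_sub_le (x + v) x
  have h2 : ‖v‖ ^ 2 ≤ 2 * ‖x + v‖ ^ 2 + 2 * ‖x‖ ^ 2 := by
    have : ‖v‖ ^ 2 ≤ (‖x + v‖ + ‖x‖) ^ 2 := by gcongr
    nlinarith [sq_nonneg (‖x + v‖ - ‖x‖)]
  have h3 : ‖x‖ ^ 2 ≤ R ^ 2 := by gcongr
  nlinarith [mul_le_mul_of_nonneg_left h2 ha, mul_le_mul_of_nonneg_left h3 ha]

variable {E : Type*} [NormedAddCommGroup E] [InnerProductSpace ℝ E] [FiniteDimensional ℝ E]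

theorem continuous_tsum_gaussian_add (L : Submodule ℤ E) [DiscreteTopology L] {a : ℝ}
    (ha : 0 < a) : Continuous fun x : E => ∑' v : L, (Real.exp (-a * ‖x + v‖ ^ 2) : ℂ) := by
  rw [continuous_iff_continuousAt]
  intro x
  have hs := (ZLattice.summable_exp_neg_mul_sq_norm L (half_pos ha)).mul_left
    (Real.exp (a * (‖x‖ + 1) ^ 2))
  have hcont : ContinuousOn (fun x : E => ∑' v : L, (Real.exp (-a * ‖x + v‖ ^ 2) : ℂ))
      (Metric.ball 0 (‖x‖ + 1)) := by
    refine continuousOn_tsum (fun v => by fun_prop) hs fun v y hy => ?_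
    rw [Complex.norm_real, Real.norm_of_nonneg (Real.exp_pos _).le]
    exact exp_neg_mul_sq_norm_add_le ha.le (mem_ball_zero_iff.1 hy).le _
  exact hcont.continuousAt (Metric.isOpen_ball.mem_nhds (by simp))

variable {ι : Type*} [Fintype ι]

theorem dualVec_neg (b : Basis ι ℝ E) (k : ι → ℤ) : dualVec b (-k) = -dualVec b k := by
  refine ext_inner_right ℝ fun x => ?_
  simp [inner_dualVec]

variable [MeasurableSpace E] [BorelSpace E]

instance vaddInvariantMeasure_submodule (L : Submodule ℤ E) :
    VAddInvariantMeasure L E (volume : Measure E) :=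
  ⟨fun v s _ => measure_preimage_add volume (v : E) s⟩

/-- Unfolding: the translates of the fundamental domain tile `E` and the character is periodic, so
the coefficient is the Fourier transform of a single Gaussian over all of `E`. -/
theorem fourierCoeff_tsum_gaussian (b : Basis ι ℝ E) {a : ℝ} (ha : 0 < a) (k : ι → ℤ) :
    fourierCoeff b (fun x => ∑' v : span ℤ (range b), (Real.exp (-a * ‖x + v‖ ^ 2) : ℂ)) k =
      (((volume.real (ZSpan.fundamentalDomain b))⁻¹ * ((Real.pi / a) ^ (finrank ℝ E / 2 : ℝ) *
        Real.exp (-(Real.pi ^ 2 / a) * ‖dualVec b k‖ ^ 2)) : ℝ) : ℂ) := by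
  have ha' : 0 < (a : ℂ).re := by simpa using ha
  set D := ZSpan.fundamentalDomain b with hD
  have hDfin : volume D < ⊤ := (ZSpan.fundamentalDomain_isBounded b).measure_lt_top
  obtain ⟨R, hR⟩ := (ZSpan.fundamentalDomain_isBounded b).exists_norm_le
  set G : E → ℂ := fun x => character b (-k) x * (Real.exp (-a * ‖x‖ ^ 2) : ℂ) with hG
  have hGeq : ∀ x, G x = Complex.exp (-(a : ℂ) * ‖x‖ ^ 2 +
      (-(2 * Real.pi * Complex.I)) * (inner ℝ (dualVec b k) x : ℝ)) := by
    intro x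
    simp only [hG, character, dualVec_neg, inner_neg_left]
    rw [Complex.ofReal_exp, ← Complex.exp_add]
    congr 1
    push_cast
    ring
  have hint : Integrable G := by
    simp_rw [funext hGeq]
    exact GaussianFourier.integrable_cexp_neg_mul_sq_norm_add ha' _ _
  have hGcont : Continuous G := by
    have := (contDiff_character b (-k)).continuous
    fun_prop
  have hGper : ∀ (v : span ℤ (range b)) (x : E),
      G (v +ᵥ x) = character b (-k) x * (Real.exp (-a * ‖x + v‖ ^ 2) : ℂ) := by
    intro v x
    have : v +ᵥ x = x + v := add_comm _ _
    simp only [hG, this, character_add_of_mem b (-k) x v.2]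
  have hbound : ∀ (v : span ℤ (range b)), ∀ x ∈ D,
      ‖G (v +ᵥ x)‖ ≤ Real.exp (a * R ^ 2) * Real.exp (-(a / 2) * ‖v‖ ^ 2) := by
    intro v x hx
    rw [hGper, norm_mul, norm_character, one_mul, Complex.norm_real,
      Real.norm_of_nonneg (Real.exp_pos _).le]
    exact exp_neg_mul_sq_norm_add_le ha.le (hR x hx) _
  have hGi : ∀ v : span ℤ (range b), Integrable (fun x => G (v +ᵥ x)) (volume.restrict D) :=
    fun v => (hint.comp_add_left (v : E)).restrict
  have hsumnorm : Summable fun v : span ℤ (range b) => ∫ x in D, ‖G (v +ᵥ x)‖ := by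
    refine Summable.of_nonneg_of_le (fun v => integral_nonneg fun x => norm_nonneg _)
      (fun v => ?_) (((ZLattice.summable_exp_neg_mul_sq_norm (span ℤ (range b))
        (half_pos ha)).mul_left (Real.exp (a * R ^ 2))).mul_right (volume.real D))
    refine (Real.le_norm_self _).trans
      (norm_setIntegral_le_of_norm_le_const hDfin fun x hx => ?_)
    rw [norm_norm]
    exact hbound v x hx
  have hunfold : ∫ x in D, character b (-k) x *
      ∑' v : span ℤ (range b), (Real.exp (-a * ‖x + v‖ ^ 2) : ℂ) = ∫ x, G x := by
    rw [(ZSpan.isAddFundamentalDomain b volume).integral_eq_tsum'' G hint,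
      integral_tsum_of_summable_integral_norm hGi hsumnorm]
    refine integral_congr_ae (Eventually.of_forall fun x => ?_)
    simp only [hGper, tsum_mul_left]
  rw [fourierCoeff, hunfold]
  simp_rw [funext hGeq]
  rw [GaussianFourier.integral_cexp_neg_mul_sq_norm_add ha', Complex.real_smul]
  push_cast
  rw [Complex.ofReal_cpow (by positivity)]
  push_cast
  congr 3
  have : (a : ℂ) ≠ 0 := by exact_mod_cast ha.ne'
  field_simp
  ring_nf
  simp

/-- **Poisson summation** for Gaussian functions: the heat trace of a flat torus in terms of the
lengths of the lattice vectors. -/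
theorem tsum_exp_dualVec_eq (b : Basis ι ℝ E) {t : ℝ} (ht : 0 < t) :
    ∑' k, Real.exp (-t * (4 * Real.pi ^ 2 * ‖dualVec b k‖ ^ 2)) =
      volume.real (ZSpan.fundamentalDomain b) * (4 * Real.pi * t) ^ (-(finrank ℝ E / 2 : ℝ)) *
        ∑' v : span ℤ (range b), Real.exp (-(1 / (4 * t)) * ‖v‖ ^ 2) := by
  -- With `a = 1/(4t)` the transformed exponent `π²/a` equals `4π²t`. The identity is the Fourier
  -- series of the periodized Gaussian evaluated at `0`.
  have ha : 0 < 1 / (4 * t) := by positivity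
  set f : E → ℂ := fun x =>
    ∑' v : span ℤ (range b), (Real.exp (-(1 / (4 * t)) * ‖x + v‖ ^ 2) : ℂ) with hf
  have hper : ∀ v ∈ span ℤ (range b), ∀ x, f (x + v) = f x := by
    intro v hv x
    have h := (Equiv.addLeft (⟨v, hv⟩ : span ℤ (range b))).tsum_eq
      fun w => (Real.exp (-(1 / (4 * t)) * ‖x + w‖ ^ 2) : ℂ)
    simpa only [hf, Equiv.coe_addLeft, Submodule.coe_add, add_assoc] using h
  have hs : Summable (fourierCoeff b f) := by
    rw [funext (fourierCoeff_tsum_gaussian b ha)]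
    exact Complex.ofRealCLM.summable (((summable_exp_neg_mul_sq_norm_dualVec b
      (by positivity)).mul_left _).mul_left _)
  have h := (hasSum_fourierCoeff b (continuous_tsum_gaussian_add _ ha) hper hs 0).tsum_eq
  simp only [funext (fourierCoeff_tsum_gaussian b ha), character, inner_zero_right,
    Complex.ofReal_zero, mul_zero, Complex.exp_zero, mul_one, zero_add] at h
  rw [← Complex.ofReal_tsum, ← Complex.ofReal_tsum, Complex.ofReal_inj, tsum_mul_left,
    tsum_mul_left] at h
  have hV := measure_fundamentalDomain_pos b
  have hrw : Real.pi / (1 / (4 * t)) = 4 * Real.pi * t := by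
    field_simp
  have hp : (0 : ℝ) < (4 * Real.pi * t) ^ (finrank ℝ E / 2 : ℝ) := by positivity
  have hexp : ∀ k, -(Real.pi ^ 2 / (1 / (4 * t))) * ‖dualVec b k‖ ^ 2 =
      -t * (4 * Real.pi ^ 2 * ‖dualVec b k‖ ^ 2) := fun k => by
    field_simp
  simp only [hexp, hrw] at h
  have hnorm : ∀ v : span ℤ (range b), ‖(v : E)‖ = ‖v‖ := fun v => rfl
  simp only [hnorm] at h
  rw [← h, Real.rpow_neg (by positivity)]
  field_simp

end LatticeFourier

/-! ### Fourier coefficients of derivatives, and periodic eigenfunctions. -/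

namespace LatticeFourier

variable {E : Type*} [NormedAddCommGroup E] [InnerProductSpace ℝ E]

theorem fderiv_add_of_periodic {f : E → ℂ} {v : E} (h : ∀ x, f (x + v) = f x) (x : E) :
    fderiv ℝ f (x + v) = fderiv ℝ f x := by
  rw [← fderiv_comp_add_right]
  simp_rw [h]

variable [FiniteDimensional ℝ E] {ι : Type*} [Fintype ι]

theorem fderiv_character (b : Basis ι ℝ E) (k : ι → ℤ) (x v : E) :
    fderiv ℝ (character b k) x v =
      2 * Real.pi * Complex.I * (inner ℝ (dualVec b k) v : ℝ) * character b k x := by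
  have h : HasFDerivAt (fun x : E => 2 * Real.pi * Complex.I * ((inner ℝ (dualVec b k) x : ℝ) : ℂ))
      ((2 * Real.pi * Complex.I) • (Complex.ofRealCLM.comp (innerSL ℝ (dualVec b k)))) x :=
    (Complex.ofRealCLM.comp (innerSL ℝ (dualVec b k))).hasFDerivAt.const_mul _
  unfold character
  rw [h.cexp.fderiv]
  simp
  ring

theorem laplacian_eq_sum_fderiv {f : E → ℂ} (hf : ContDiff ℝ ∞ f) (x : E) :
    (Δ f) x = ∑ i, fderiv ℝ (fun y => fderiv ℝ f y (stdOrthonormalBasis ℝ E i)) x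
      (stdOrthonormalBasis ℝ E i) := by
  rw [InnerProductSpace.laplacian_eq_iteratedFDeriv_stdOrthonormalBasis]
  refine Finset.sum_congr rfl fun i _ => ?_
  have hd : DifferentiableAt ℝ (fderiv ℝ f) x :=
    ((hf.fderiv_right (m := ∞) (by norm_cast)).differentiable (by simp)).differentiableAt
  rw [iteratedFDeriv_two_apply, fderiv_clm_apply hd (by fun_prop)]
  simp

theorem laplacian_character (b : Basis ι ℝ E) (k : ι → ℤ) (x : E) :
    (Δ (character b k)) x =
      -((4 * Real.pi ^ 2 * ‖dualVec b k‖ ^ 2 : ℝ) : ℂ) * character b k x := by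
  rw [laplacian_eq_sum_fderiv (contDiff_character b k)]
  have h : ∀ v : E, fderiv ℝ (fun y => fderiv ℝ (character b k) y v) x v =
      -(4 * Real.pi ^ 2 * ((inner ℝ (dualVec b k) v) ^ 2 : ℝ) : ℂ) * character b k x := by
    intro v
    have hd : DifferentiableAt ℝ (character b k) x :=
      ((contDiff_character b k).differentiable (by simp)).differentiableAt
    simp_rw [fderiv_character]
    rw [fderiv_const_mul hd]
    simp only [smul_apply, fderiv_character, smul_eq_mul]
    push_cast
    linear_combination (4 * Real.pi ^ 2 * (inner ℝ (dualVec b k) v : ℂ) ^ 2 * character b k x) *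
      Complex.I_sq
  simp_rw [h]
  rw [← Finset.sum_mul, Finset.sum_neg_distrib, ← Finset.mul_sum, ← Complex.ofReal_sum,
    (stdOrthonormalBasis ℝ E).sum_sq_inner_left]
  push_cast
  rfl

variable [MeasurableSpace E] [BorelSpace E]

theorem setIntegral_fundamentalDomain_comp_add (b : Basis ι ℝ E) {f : E → ℂ}
    (hper : ∀ v ∈ span ℤ (range b), ∀ x, f (x + v) = f x) (h : E) :
    ∫ x in ZSpan.fundamentalDomain b, f (x + h) = ∫ x in ZSpan.fundamentalDomain b, f x := by
  have hD := ZSpan.isAddFundamentalDomain b (volume : Measure E)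
  have hD' : IsAddFundamentalDomain (span ℤ (range b)) (h +ᵥ ZSpan.fundamentalDomain b)
    (volume : Measure E) := hD.vadd_of_comm h
  rw [← hD'.setIntegral_eq hD (f := f) fun v x => by
    rw [← hper v v.2 x, add_comm]; rfl]
  have hpre : (fun x => x + h) ⁻¹' (h +ᵥ ZSpan.fundamentalDomain b) =
      ZSpan.fundamentalDomain b := by
    ext x
    rw [mem_preimage, mem_vadd_set_iff_neg_vadd_mem, vadd_eq_add, add_comm x, neg_add_cancel_left]
  have hpre' := (measurePreserving_add_right volume h).setIntegral_preimage_emb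
    (measurableEmbedding_addRight h) f (h +ᵥ ZSpan.fundamentalDomain b)
  rwa [hpre] at hpre'

/-- The integral of a derivative of a periodic function over a fundamental domain vanishes. -/
theorem setIntegral_fderiv_eq_zero (b : Basis ι ℝ E) {f : E → ℂ} (hf : ContDiff ℝ ∞ f)
    (hper : ∀ v ∈ span ℤ (range b), ∀ x, f (x + v) = f x) (h : E) :
    ∫ x in ZSpan.fundamentalDomain b, fderiv ℝ f x h = 0 := by
  set D := ZSpan.fundamentalDomain b
  have hDfin : volume D < ⊤ := (ZSpan.fundamentalDomain_isBounded b).measure_lt_top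
  have : IsFiniteMeasure (volume.restrict D) := ⟨by simpa using hDfin⟩
  have hf' : Continuous fun x => fderiv ℝ f x h :=
    (hf.continuous_fderiv (by simp)).clm_apply continuous_const
  obtain ⟨C, hC⟩ := (IsZLattice.isCompact_range_of_periodic (span ℤ (range b)) _ hf'
    fun x v hv => by rw [fderiv_add_of_periodic (hper v hv)]).isBounded.exists_norm_le
  obtain ⟨C₀, hC₀⟩ := (IsZLattice.isCompact_range_of_periodic (span ℤ (range b)) _ hf.continuous
    fun x v hv => hper v hv x).isBounded.exists_norm_le
  -- Differentiate `s ↦ ∫ f (x + s • h)` under the integral; this function is constant by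
  -- translation invariance. Periodic continuous functions have compact range, hence the constant
  -- majorant.
  have key := hasDerivAt_integral_of_dominated_loc_of_deriv_le (μ := volume.restrict D)
    (F := fun (s : ℝ) x => f (x + s • h)) (F' := fun s x => fderiv ℝ f (x + s • h) h)
    (x₀ := 0) (s := univ) (bound := fun _ => C) univ_mem
    (Eventually.of_forall fun s =>
      (hf.continuous.comp (by fun_prop : Continuous fun x => x + s • h)).aestronglyMeasurable)
    (Integrable.of_bound
      (hf.continuous.comp (by fun_prop : Continuous fun x => x + (0 : ℝ) • h)).aestronglyMeasurable
      C₀ (Eventually.of_forall fun x => hC₀ _ (mem_range_self _)))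
    (hf'.comp (by fun_prop : Continuous fun x => x + (0 : ℝ) • h)).aestronglyMeasurable
    (Eventually.of_forall fun x s _ => hC _ ⟨x + s • h, rfl⟩)
    (integrable_const C)
    (Eventually.of_forall fun x s _ => by
      have h1 : HasDerivAt (fun s : ℝ => x + s • h) h s := by
        simpa using ((hasDerivAt_id s).smul_const h).const_add x
      exact ((hf.differentiable (by simp)) _).hasFDerivAt.comp_hasDerivAt s h1)
  have hd := key.2
  simp only [zero_smul, add_zero] at hd
  have hconst : (fun s : ℝ => ∫ x in D, f (x + s • h)) = fun _ => ∫ x in D, f x :=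
    funext fun s => setIntegral_fundamentalDomain_comp_add b hper (s • h)
  rw [hconst] at hd
  exact hd.unique (hasDerivAt_const _ _)

/-- Integration by parts: the derivative of the periodic product `character b (-k) * f` has integral
zero. -/
theorem fourierCoeff_fderiv (b : Basis ι ℝ E) {f : E → ℂ} (hf : ContDiff ℝ ∞ f)
    (hper : ∀ v ∈ span ℤ (range b), ∀ x, f (x + v) = f x) (h : E) (k : ι → ℤ) :
    fourierCoeff b (fun x => fderiv ℝ f x h) k =
      2 * Real.pi * Complex.I * (inner ℝ (dualVec b k) h : ℝ) * fourierCoeff b f k := by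
  have hDb := ZSpan.fundamentalDomain_isBounded b
  have hχ := contDiff_character b (-k)
  have hz := setIntegral_fderiv_eq_zero b (hχ.mul hf)
    (fun v hv x => by rw [character_add_of_mem b _ _ hv, hper v hv]) h
  have hint : ∀ g : E → ℂ, Continuous g →
      IntegrableOn g (ZSpan.fundamentalDomain b) := fun g hg =>
    (hg.continuousOn.integrableOn_compact hDb.isCompact_closure).mono_set subset_closure
  have hprod : ∀ x, fderiv ℝ (fun x => character b (-k) x * f x) x h =
      character b (-k) x * fderiv ℝ f x h -
      2 * Real.pi * Complex.I * (inner ℝ (dualVec b k) h : ℝ) * (character b (-k) x * f x) := by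
    intro x
    rw [fderiv_fun_mul (hχ.differentiable (by simp) x) (hf.differentiable (by simp) x)]
    simp [fderiv_character, dualVec_neg]
    ring
  have hf' : Continuous fun x => fderiv ℝ f x h :=
    (hf.continuous_fderiv (by simp)).clm_apply continuous_const
  simp_rw [hprod] at hz
  have h₁ : Continuous fun x => character b (-k) x * fderiv ℝ f x h := hχ.continuous.mul hf'
  have h₂ : Continuous fun x => 2 * Real.pi * Complex.I * (inner ℝ (dualVec b k) h : ℝ) *
      (character b (-k) x * f x) := continuous_const.mul (hχ.continuous.mul hf.continuous)
  rw [integral_sub (hint _ h₁) (hint _ h₂), integral_const_mul, sub_eq_zero] at hz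
  rw [fourierCoeff, hz, fourierCoeff, mul_smul_comm]

theorem fourierCoeff_laplacian (b : Basis ι ℝ E) {f : E → ℂ} (hf : ContDiff ℝ ∞ f)
    (hper : ∀ v ∈ span ℤ (range b), ∀ x, f (x + v) = f x) (k : ι → ℤ) :
    fourierCoeff b (Δ f) k =
      -((4 * Real.pi ^ 2 * ‖dualVec b k‖ ^ 2 : ℝ) : ℂ) * fourierCoeff b f k := by
  set e := stdOrthonormalBasis ℝ E
  have hDb := ZSpan.fundamentalDomain_isBounded b
  have hf' : ∀ h, ContDiff ℝ ∞ fun x => fderiv ℝ f x h := fun h =>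
    (hf.fderiv_right (m := ∞) (by norm_cast)).clm_apply contDiff_const
  have hint : ∀ i, IntegrableOn (fun x => character b (-k) x *
      fderiv ℝ (fun y => fderiv ℝ f y (e i)) x (e i)) (ZSpan.fundamentalDomain b) := fun i =>
    (((contDiff_character b (-k)).continuous.mul
      (((hf' (e i)).continuous_fderiv (by simp)).clm_apply
        continuous_const)).continuousOn.integrableOn_compact hDb.isCompact_closure).mono_set
      subset_closure
  have hsum : fourierCoeff b (Δ f) k = ∑ i, fourierCoeff b
      (fun x => fderiv ℝ (fun y => fderiv ℝ f y (e i)) x (e i)) k := by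
    simp_rw [fourierCoeff, laplacian_eq_sum_fderiv hf, Finset.mul_sum]
    rw [integral_finsetSum _ fun i _ => hint i, Finset.smul_sum]
  rw [hsum]
  have hi : ∀ i, fourierCoeff b (fun x => fderiv ℝ (fun y => fderiv ℝ f y (e i)) x (e i)) k =
      -(4 * Real.pi ^ 2 * ((inner ℝ (dualVec b k) (e i)) ^ 2 : ℝ) : ℂ) * fourierCoeff b f k := by
    intro i
    rw [fourierCoeff_fderiv b (hf' (e i))
      (fun v hv x => by rw [fderiv_add_of_periodic (hper v hv)]), fourierCoeff_fderiv b hf hper]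
    push_cast
    linear_combination (4 * Real.pi ^ 2 * (inner ℝ (dualVec b k) (e i) : ℂ) ^ 2 *
      fourierCoeff b f k) * Complex.I_sq
  simp_rw [hi]
  rw [← Finset.sum_mul, Finset.sum_neg_distrib, ← Finset.mul_sum, ← Complex.ofReal_sum,
    e.sum_sq_inner_left]
  push_cast
  rfl

/-- A periodic eigenfunction of the Laplace operator is a finite sum of characters. -/
theorem eq_sum_character_of_laplacian_eq (b : Basis ι ℝ E) {f : E → ℂ} (hf : ContDiff ℝ ∞ f)
    (hper : ∀ v ∈ span ℤ (range b), ∀ x, f (x + v) = f x) {m : ℝ}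
    (heig : ∀ x, (Δ f) x = -(m : ℂ) * f x) :
    ∃ s : Finset (ι → ℤ), (∀ k ∈ s, 4 * Real.pi ^ 2 * ‖dualVec b k‖ ^ 2 = m) ∧
      ∀ x, f x = ∑ k ∈ s, fourierCoeff b f k * character b k x := by
  -- Comparing coefficients in the eigenvalue equation kills all frequencies with another
  -- eigenvalue. Only finitely many remain, so the Fourier series converges trivially.
  have hzero : ∀ k, 4 * Real.pi ^ 2 * ‖dualVec b k‖ ^ 2 ≠ m → fourierCoeff b f k = 0 := by
    intro k hk
    have h := fourierCoeff_laplacian b hf hper k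
    have h2 : fourierCoeff b (Δ f) k = -(m : ℂ) * fourierCoeff b f k := by
      rw [fourierCoeff, fourierCoeff]
      simp_rw [heig, mul_left_comm _ (-(m : ℂ))]
      rw [integral_const_mul, mul_smul_comm]
    rw [h2] at h
    have h3 : (((4 * Real.pi ^ 2 * ‖dualVec b k‖ ^ 2 - m : ℝ)) : ℂ) * fourierCoeff b f k = 0 := by
      rw [Complex.ofReal_sub]
      linear_combination h
    refine (mul_eq_zero.1 h3).resolve_left ?_
    exact_mod_cast sub_ne_zero.2 hk
  have hfin : {k | 4 * Real.pi ^ 2 * ‖dualVec b k‖ ^ 2 = m}.Finite :=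
    (finite_eigenvalue_le b m).subset fun k hk => le_of_eq hk
  refine ⟨hfin.toFinset, fun k hk => by simpa using hk, fun x => ?_⟩
  have hout : ∀ k ∉ hfin.toFinset, fourierCoeff b f k = 0 := fun k hk => hzero k (by simpa using hk)
  have hs := hasSum_fourierCoeff b hf.continuous hper (summable_of_ne_finset_zero hout) x
  exact hs.unique (hasSum_sum_of_ne_finset_zero fun k hk => by rw [hout k hk, zero_mul])

end LatticeFourier

/-! ### The spectrum of a flat torus. -/

namespace FlatTorus

open LatticeFourier

variable {n : ℕ}

section Spectrum

variable (b : Basis (Fin n) ℝ (EuclideanSpace ℝ (Fin n)))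

/-- The characters as smooth functions on the torus. -/
def torusCharacter (k : Fin n → ℤ) : smoothFunctions (span ℤ (range b)) :=
  ⟨fun q => Quotient.liftOn' q (character b k) fun x y hxy => by
    have hv : x - y ∈ span ℤ (range b) := (Submodule.Quotient.eq _).1 (Quotient.sound' hxy)
    rw [← character_add_of_mem b k y hv, add_sub_cancel], contDiff_character b k⟩

theorem mem_eigenspace_laplace_iff {Λ : Submodule ℤ (EuclideanSpace ℝ (Fin n))}
    (f : smoothFunctions Λ) (m : ℝ) :
    f ∈ (laplace Λ).eigenspace (m : ℂ) ↔
      ∀ x, (Δ ((f : FlatTorus Λ → ℂ) ∘ proj Λ)) x =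
        -(m : ℂ) * ((f : FlatTorus Λ → ℂ) ∘ proj Λ) x := by
  rw [Module.End.mem_eigenspace_iff, Subtype.ext_iff, funext_iff]
  constructor
  · intro h x
    have hx : -(Δ ((f : FlatTorus Λ → ℂ) ∘ proj Λ)) x =
      (m : ℂ) * ((f : FlatTorus Λ → ℂ) ∘ proj Λ) x := h (proj Λ x)
    linear_combination -hx
  · intro h q
    induction q using Submodule.Quotient.induction_on with
    | _ x =>
      change -(Δ ((f : FlatTorus Λ → ℂ) ∘ proj Λ)) x =
        (m : ℂ) * ((f : FlatTorus Λ → ℂ) ∘ proj Λ) x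
      rw [h x]
      ring

/-- Inherited from the orthonormality of the Fourier monomials in `L²` of the standard torus, pulled
back along the surjective `torusMap`. -/
theorem linearIndependent_torusCharacter : LinearIndependent ℂ (torusCharacter b) := by
  have h1 : LinearIndependent ℂ (UnitAddTorus.mFourier (d := Fin n)) :=
    LinearIndependent.of_comp _ UnitAddTorus.orthonormal_mFourier.linearIndependent
  let φ : C(UnitAddTorus (Fin n), ℂ) →ₗ[ℂ] (EuclideanSpace ℝ (Fin n) → ℂ) :=
    { toFun := fun F x => F (torusMap b x)
      map_add' := fun _ _ => rfl
      map_smul' := fun _ _ => rfl }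
  have hφ : LinearMap.ker φ = ⊥ := LinearMap.ker_eq_bot.2 fun F G h => by
    ext y
    obtain ⟨x, rfl⟩ := (isOpenQuotientMap_torusMap b).surjective y
    exact congrFun h x
  let ψ : smoothFunctions (span ℤ (range b)) →ₗ[ℂ] (EuclideanSpace ℝ (Fin n) → ℂ) :=
    { toFun := fun f x => (f : FlatTorus (span ℤ (range b)) → ℂ) (proj _ x)
      map_add' := fun _ _ => rfl
      map_smul' := fun _ _ => rfl }
  refine LinearIndependent.of_comp ψ ?_
  have heq : ψ ∘ torusCharacter b = φ ∘ UnitAddTorus.mFourier := by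
    ext k x
    exact (mFourier_torusMap b k x).symm
  rw [heq]
  exact h1.map' φ hφ

theorem spectralSubspace_eq_span (x : ℝ) :
    spectralSubspace (span ℤ (range b)) x =
      span ℂ (range fun k : {k | 4 * Real.pi ^ 2 * ‖dualVec b k‖ ^ 2 ≤ x} =>
        torusCharacter b k) := by
  apply le_antisymm
  · refine iSup₂_le fun m hm f hf => ?_
    rw [mem_eigenspace_laplace_iff] at hf
    obtain ⟨s, hs, hsum⟩ := eq_sum_character_of_laplacian_eq b f.2
      (fun v hv x => congrArg (f : FlatTorus (span ℤ (range b)) → ℂ) (proj_add_of_mem hv x)) hf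
    have hfs : f = ∑ k ∈ s, fourierCoeff b
        ((f : FlatTorus (span ℤ (range b)) → ℂ) ∘ proj _) k • torusCharacter b k := by
      ext q
      induction q using Submodule.Quotient.induction_on with
      | _ x =>
        refine (hsum x).trans ?_
        simp only [Submodule.coe_sum, Submodule.coe_smul, Finset.sum_apply, Pi.smul_apply,
          smul_eq_mul]
        rfl
    rw [hfs]
    exact sum_mem fun k hk => smul_mem _ _ (subset_span ⟨⟨k, (hs k hk).trans_le hm⟩, rfl⟩)
  · rw [span_le]
    rintro _ ⟨⟨k, hk⟩, rfl⟩
    refine mem_iSup_of_mem _ (mem_iSup_of_mem hk ?_)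
    rw [mem_eigenspace_laplace_iff]
    exact laplacian_character b k

theorem counting_eq_ncard (x : ℝ) :
    counting (span ℤ (range b)) x =
      ({k | 4 * Real.pi ^ 2 * ‖dualVec b k‖ ^ 2 ≤ x}.ncard : Cardinal) := by
  have hli : LinearIndependent ℂ (fun k : {k | 4 * Real.pi ^ 2 * ‖dualVec b k‖ ^ 2 ≤ x} =>
      torusCharacter b k) :=
    (linearIndependent_torusCharacter b).comp _ Subtype.val_injective
  rw [counting, spectralSubspace_eq_span, rank_span hli, Cardinal.mk_range_eq _ hli.injective,
    Set.cast_ncard (finite_eigenvalue_le b x)]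

end Spectrum

/-! ### Closed geodesics and the systole. -/

/-- The lengths of the closed geodesics are the lengths of the nonzero lattice vectors. -/
theorem exists_isClosedGeodesic_iff (Λ : Submodule ℤ (EuclideanSpace ℝ (Fin n))) (L : ℝ) :
    (∃ γ : ℝ → FlatTorus Λ, IsClosedGeodesic Λ γ L) ↔ ∃ v : Λ, v ≠ 0 ∧ L = ‖v‖ := by
  constructor
  · rintro ⟨γ, hγ, c, hc, hproj, hc2, ⟨t₀, ht₀⟩, rfl⟩
    have hcd : Differentiable ℝ c := hc.differentiable (by simp)
    have hc' : Differentiable ℝ (deriv c) :=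
      (contDiff_infty_iff_deriv.1 hc).2.differentiable (by simp)
    have hconst : ∀ t, deriv c t = deriv c 0 := fun t =>
      is_const_of_deriv_eq_zero hc' hc2 t 0
    have haff : ∀ t, c t - t • deriv c 0 = c 0 := by
      intro t
      have hd : ∀ s, HasDerivAt (fun t => c t - t • deriv c 0) 0 s := fun s => by
        have h1 := (hcd s).hasDerivAt.sub ((hasDerivAt_id s).smul_const (deriv c 0))
        rwa [one_smul, hconst s, sub_self] at h1
      have := is_const_of_deriv_eq_zero (fun s => (hd s).differentiableAt) (fun s => (hd s).deriv)
        t 0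
      simpa using this
    -- The lift is affine, so its displacement over one period is its velocity; closing up puts it
    -- in `Λ`.
    have hmem : deriv c 0 ∈ Λ := by
      have h := hγ 0
      rw [hproj, hproj] at h
      have h' : c (0 + 1) - c 0 ∈ Λ := (Submodule.Quotient.eq Λ).1 h
      rwa [zero_add, ← haff 1, one_smul, sub_sub_cancel] at h'
    refine ⟨⟨deriv c 0, hmem⟩, fun h => ht₀ ?_, ?_⟩
    · rw [hconst]
      exact congrArg Subtype.val h
    · simp_rw [hconst]
      simp
  · rintro ⟨v, hv, rfl⟩
    have hd : ∀ t, HasDerivAt (fun t : ℝ => t • (v : EuclideanSpace ℝ (Fin n))) v t := fun t => by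
      simpa using (hasDerivAt_id t).smul_const (v : EuclideanSpace ℝ (Fin n))
    have hd' : deriv (fun t : ℝ => t • (v : EuclideanSpace ℝ (Fin n))) = fun _ => ↑v :=
      funext fun t => (hd t).deriv
    refine ⟨fun t => proj Λ (t • (v : EuclideanSpace ℝ (Fin n))), fun t => ?_,
      fun t => t • (v : EuclideanSpace ℝ (Fin n)), by fun_prop, fun t => rfl, fun t => ?_,
      ⟨0, ?_⟩, ?_⟩
    · simp only [add_smul, one_smul, proj_add_of_mem v.2]
    · rw [hd']
      simp
    · rw [hd']
      simpa using hv
    · rw [hd']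
      simp

theorem systole_le_of_exists_norm_le (Λ₁ Λ₂ : Submodule ℤ (EuclideanSpace ℝ (Fin n)))
    (h₁ : ∀ v : Λ₁, v ≠ 0 → ∃ w : Λ₂, w ≠ 0 ∧ ‖w‖ ≤ ‖v‖)
    (h₂ : ∀ v : Λ₂, v ≠ 0 → ∃ w : Λ₁, w ≠ 0 ∧ ‖w‖ ≤ ‖v‖) : systole Λ₁ ≤ systole Λ₂ := by
  have hbdd : BddBelow {L : ℝ | ∃ v : Λ₁, v ≠ 0 ∧ L = ‖v‖} :=
    ⟨0, by rintro _ ⟨v, -, rfl⟩; exact norm_nonneg v⟩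
  simp only [systole, exists_isClosedGeodesic_iff]
  rcases {L : ℝ | ∃ v : Λ₂, v ≠ 0 ∧ L = ‖v‖}.eq_empty_or_nonempty with he | hne
  -- Without nonzero vectors in `Λ₂` its systole is `sInf ∅ = 0`, so `Λ₁` must be shown to have none
  -- either.
  · have he' : {L : ℝ | ∃ v : Λ₁, v ≠ 0 ∧ L = ‖v‖} = ∅ := by
      refine eq_empty_of_forall_notMem ?_
      rintro _ ⟨v, hv, rfl⟩
      obtain ⟨w, hw, -⟩ := h₁ v hv
      exact notMem_empty ‖w‖ (he ▸ ⟨w, hw, rfl⟩)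
    rw [he, he']
  · refine le_csInf hne ?_
    rintro _ ⟨v, hv, rfl⟩
    obtain ⟨w, hw, hle⟩ := h₂ v hv
    exact (csInf_le hbdd ⟨w, hw, rfl⟩).trans hle

/-! ### Comparison of the two tori and conclusion. -/

/-- Tori of equal volume one of which is subspectral to the other one have the same Gaussian
sums. -/
theorem tsum_exp_eq_of_subspectral (b₁ b₂ : Basis (Fin n) ℝ (EuclideanSpace ℝ (Fin n)))
    (hvol : volume.real (ZSpan.fundamentalDomain b₁) = volume.real (ZSpan.fundamentalDomain b₂))
    (hsub : Subspectral (span ℤ (range b₂)) (span ℤ (range b₁))) {a : ℝ} (ha : 0 < a) :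
    ∑' v : span ℤ (range b₁), Real.exp (-a * ‖v‖ ^ 2) =
      ∑' v : span ℤ (range b₂), Real.exp (-a * ‖v‖ ^ 2) := by
  set A₁ : ℝ → ℝ := fun a => ∑' v : span ℤ (range b₁), Real.exp (-a * ‖v‖ ^ 2) with hA₁
  set A₂ : ℝ → ℝ := fun a => ∑' v : span ℤ (range b₂), Real.exp (-a * ‖v‖ ^ 2) with hA₂
  have hle : ∀ x, {k | 4 * Real.pi ^ 2 * ‖dualVec b₁ k‖ ^ 2 ≤ x}.ncard ≤
      {k | 4 * Real.pi ^ 2 * ‖dualVec b₂ k‖ ^ 2 ≤ x}.ncard := fun x => by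
    have := hsub x
    rw [counting_eq_ncard, counting_eq_ncard] at this
    exact_mod_cast this
  have hs : ∀ b : Basis (Fin n) ℝ (EuclideanSpace ℝ (Fin n)), ∀ t : ℝ, 0 < t →
      Summable fun k => Real.exp (-t * (4 * Real.pi ^ 2 * ‖dualVec b k‖ ^ 2)) := by
    intro b t ht
    convert summable_exp_neg_mul_sq_norm_dualVec b
      (show 0 < t * (4 * Real.pi ^ 2) by positivity) using 3
    ring
  set r : ℝ := finrank ℝ (EuclideanSpace ℝ (Fin n)) / 2 with hr
  set V := volume.real (ZSpan.fundamentalDomain b₂) with hV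
  have hV0 : 0 < V := measure_fundamentalDomain_pos b₂
  -- the difference of the heat traces at time `1 / (4 * a)`, divided by the time
  set p : ℝ → ℝ := fun a => V * (Real.pi / a) ^ (-r) * (4 * a) * (A₂ a - A₁ a) with hp
  have hpeq : ∀ a, 0 < a → p a =
      (∑' k, Real.exp (-(1 / (4 * a)) * (4 * Real.pi ^ 2 * ‖dualVec b₂ k‖ ^ 2)) -
        ∑' k, Real.exp (-(1 / (4 * a)) * (4 * Real.pi ^ 2 * ‖dualVec b₁ k‖ ^ 2))) /
        (1 / (4 * a)) := by
    intro a ha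
    have ht : 0 < 1 / (4 * a) := by positivity
    have e1 : 4 * Real.pi * (1 / (4 * a)) = Real.pi / a := by field_simp
    have e2 : 1 / (4 * (1 / (4 * a))) = a := by field_simp
    rw [tsum_exp_dualVec_eq b₁ ht, tsum_exp_dualVec_eq b₂ ht, hvol, e1, e2, ← hr, ← hV]
    simp only [hp, hA₁, hA₂]
    field_simp
  -- The time `1 / (4 * a)` decreases in `a`, so the nonincreasing quotient becomes nondecreasing.
  have hmono : ∀ a a', 0 < a → a ≤ a' → p a ≤ p a' := by
    intro a a' ha haa
    have ha' : 0 < a' := ha.trans_le haa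
    rw [hpeq a ha, hpeq a' ha']
    exact heatTrace_sub_div_antitone (finite_eigenvalue_le b₁) (finite_eigenvalue_le b₂)
      (fun k => by positivity) (fun k => by positivity) (hs b₁) (hs b₂) hle (by positivity)
      (by gcongr)
  have hnonneg : 0 ≤ p a := by
    rw [hpeq a ha]
    have ht : 0 < 1 / (4 * a) := by positivity
    exact div_nonneg (sub_nonneg.2 (heatTrace_le_heatTrace (finite_eigenvalue_le b₁)
      (finite_eigenvalue_le b₂) (hs b₁) (hs b₂) hle ht)) ht.le
  obtain ⟨c, hc, C, hC⟩ := ZLattice.exists_tsum_exp_sub_one_le (span ℤ (range b₂))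
  have hlim : Tendsto (fun a : ℝ => (V * Real.pi ^ (-r) * 4 * C) * (a ^ (r + 1) *
      Real.exp (-c * a))) atTop (𝓝 0) := by
    simpa using (tendsto_rpow_mul_exp_neg_mul_atTop_nhds_zero (r + 1) c hc).const_mul
      (V * Real.pi ^ (-r) * 4 * C)
  obtain ⟨_, _, _, hC₁⟩ := ZLattice.exists_tsum_exp_sub_one_le (span ℤ (range b₁))
  have hbound : ∀ᶠ a' in atTop, p a ≤ (V * Real.pi ^ (-r) * 4 * C) * (a' ^ (r + 1) *
      Real.exp (-c * a')) := by
    filter_upwards [eventually_ge_atTop 1, eventually_ge_atTop a] with a' h1 haa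
    have ha' : 0 < a' := by linarith
    refine (hmono a a' ha haa).trans ?_
    -- The terms `1` from the zero vectors cancel, and the rest of `A₁` is nonnegative.
    have hD : A₂ a' - A₁ a' ≤ C * Real.exp (-c * a') := by
      have := (hC a' h1).2
      have := (hC₁ a' h1).1
      simp only [hA₁, hA₂]
      linarith
    have hpow : (Real.pi / a') ^ (-r) * a' = Real.pi ^ (-r) * a' ^ (r + 1) := by
      rw [Real.div_rpow Real.pi_pos.le ha'.le, Real.rpow_add_one ha'.ne', Real.rpow_neg ha'.le]
      field_simp
    calc p a' = V * ((Real.pi / a') ^ (-r) * a') * 4 * (A₂ a' - A₁ a') := by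
          simp only [hp]
          ring
      _ ≤ V * ((Real.pi / a') ^ (-r) * a') * 4 * (C * Real.exp (-c * a')) := by gcongr
      _ = _ := by
          rw [hpow]
          ring
  -- `0 ≤ p a ≤ p a'`, and the bound on `p a'` tends to `0` as `a' → ∞`.
  have hzero : p a = 0 := le_antisymm (ge_of_tendsto hlim hbound) hnonneg
  have hne : V * (Real.pi / a) ^ (-r) * (4 * a) ≠ 0 := by positivity
  have := (mul_eq_zero.1 hzero).resolve_left hne
  exact (sub_eq_zero.1 this).symm

end FlatTorus
end

theorem mainTheorem10 (n : ℕ) (Λ₁ Λ₂ : Submodule ℤ (EuclideanSpace ℝ (Fin n)))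
    [DiscreteTopology Λ₁] [IsZLattice ℝ Λ₁] [DiscreteTopology Λ₂] [IsZLattice ℝ Λ₂]
    (hvol : FlatTorus.vol Λ₁ = FlatTorus.vol Λ₂)
    (hsub : FlatTorus.Subspectral Λ₂ Λ₁) :
    FlatTorus.systole Λ₁ ≤ FlatTorus.systole Λ₂ ∧
      FlatTorus.systole Λ₂ ≤ FlatTorus.systole Λ₁ := by
  have hbasis : ∀ (Λ : Submodule ℤ (EuclideanSpace ℝ (Fin n))) [DiscreteTopology Λ]
      [IsZLattice ℝ Λ], ∃ b : Module.Basis (Fin n) ℝ (EuclideanSpace ℝ (Fin n)),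
      Submodule.span ℤ (Set.range b) = Λ := by
    intro Λ _ _
    have e : Module.finrank ℤ Λ = n := by
      rw [ZLattice.rank ℝ Λ, finrank_euclideanSpace_fin]
    exact ⟨(Module.finBasisOfFinrankEq ℤ Λ e).ofZLatticeBasis ℝ Λ,
      Module.Basis.ofZLatticeBasis_span ℝ Λ _⟩
  obtain ⟨b₁, rfl⟩ := hbasis Λ₁
  obtain ⟨b₂, rfl⟩ := hbasis Λ₂
  rw [FlatTorus.vol, FlatTorus.vol,
    ZLattice.covolume_eq_measure_fundamentalDomain _ _ (ZSpan.isAddFundamentalDomain b₁ _),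
    ZLattice.covolume_eq_measure_fundamentalDomain _ _ (ZSpan.isAddFundamentalDomain b₂ _)] at hvol
  have h := fun a (ha : 0 < a) => FlatTorus.tsum_exp_eq_of_subspectral b₁ b₂ hvol hsub (a := a) ha
  have h₁ := ZLattice.exists_norm_le_of_tsum_exp_eq _ _ h
  have h₂ := ZLattice.exists_norm_le_of_tsum_exp_eq _ _ fun a ha => (h a ha).symm
  exact ⟨FlatTorus.systole_le_of_exists_norm_le _ _ h₂ h₁,
    FlatTorus.systole_le_of_exists_norm_le _ _ h₁ h₂⟩
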